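/- Let $\mathbb{K}$ be a field, $n\ge 3$, and let $C_n$ be the $n$-cycle graph on the vertex set $\{1,\dots,n\}$ with adjacency matrix $(a_{i,j})$ and Laplacian matrix $\Lambda$. Let $\Pi=\{V_1,\dots,V_k\}$ be a partition of $\{1,\dots,n\}$ into non-empty sets each of which induces a connected subgraph of $C_n$. Fix the part $V_k$ (the sink) and a vertex $q\in V_k$. For a part $V$ let $b_{V}\in\mathbb{Z}^n$ be the sum of the rows of $\Lambda$ indexed by the elements of $V$, and let $L_\Pi\subseteq\mathbb{Z}^n$ be the lattice generated by $b_{V_1},\dots,b_{V_k}$. The toppling ideal is $$I_\Pi=\langle \mathbf{x}^{\mathbf u}-\mathbf{x}^{\mathbf v} \mid \mathbf u,\mathbf v\in\mathbb{N}^n,\ \mathbf u-\mathbf v\in L_\Pi\rangle\subseteq R_n=\mathbb{K}[x_1,\dots,x_n].$$ A parset is a union of parts of $\Pi$; it is a connected parset if it is non-empty and induces a connected subgraph of $C_n$. For $S\subseteq\{1,\dots,n\}$ with complement $\overline S$ put $\mathbf{x}^{S\to\overline S}=\prod_{i\in S}x_i^{d_i}$ with $d_i=\sum_{j\in\overline S}a_{i,j}$.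 The $G$-parking function ideal $M_\Pi$ with sink $V_k$ is the ideal of $R_n$ generated by the monomials $\mathbf{x}^{S\to\overline S}$, where $S$ ranges over the connected parsets not containing $V_k$. Let $\lambda\in\mathbb{N}^n$ (where $0\in\mathbb N$) be a weight vector with $b_{V_i}\cdot\lambda>0$ for all $i\ne k$; let $T$ be a spanning tree of $C_n$ rooted at $q$, and choose a total order on the variables such that $x_i<x_j$ whenever $j\neq i$ is a descendant of $i$ in $T$. Let $m_{\mathrm{rev}}$ be the monomial order that first compares the weights $\lambda\cdot\mathbf u$ and breaks ties by the (graded) reverse lexicographic order induced by this order of the variables: $\mathbf{x}^{\mathbf u}<\mathbf{x}^{\mathbf v}$ if $\deg\mathbf{x}^{\mathbf u}<\deg\mathbf{x}^{\mathbf v}$, or if the degrees are equal and, at the smallest variable $x_i$ with $u_i\ne v_i$, one has $u_i>v_i$. **Theorem.** Such weight vectors, spanning trees and orders of the variables exist, and for every choice of them the set $$\{\mathbf{x}^{S\to\overline S}-\mathbf{x}^{\overline S\to S}\mid S \text{ is a connected parset of } (C_n,\Pi) \text{ not containing } V_k\}$$ is a Gröbner basis of $I_\Pi$ with respect to $m_{\mathrm{rev}}$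 (that is, a finite set of non-zero elements of $I_\Pi$ whose initial terms generate the initial ideal of $I_\Pi$). Moreover, the initial ideal of $I_\Pi$ with respect to $m_{\mathrm{rev}}$ is $M_\Pi$. -/

import Mathlib

open MvPolynomial

noncomputable section

/-! ### Weighted reverse lexicographic monomial orders -/

namespace WeightedRevLex

variable {n : ℕ}

/-- The `lam`-weight of the monomial with exponent vector `a`. -/
def weight (lam : Fin n → ℕ) (a : Fin n →₀ ℕ) : ℕ := ∑ i, lam i * a i

/-- The total degree of the monomial with exponent vector `a`. -/
def totalDegree (a : Fin n →₀ ℕ) : ℕ := ∑ i, a i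

/-- The strict comparison `x^a < x^b` of exponent vectors: first compare the weights given by
`lam`; break ties by the (graded) reverse lexicographic order attached to the ordering of the
variables in which `x_i < x_j` means `rank i < rank j`.  In the reverse lexicographic order of
monomials of the same degree, `x^a < x^b` when at the smallest variable `x_i` whose exponents
differ, the exponent in `x^a` is the larger one. -/
def Less (lam : Fin n → ℕ) (rank : Equiv.Perm (Fin n)) (a b : Fin n →₀ ℕ) : Prop :=
  weight lam a < weight lam b ∨
    (weight lam a = weight lam b ∧
      (totalDegree a < totalDegree b ∨
        (totalDegree a = totalDegree b ∧
          ∃ i, b i < a i ∧ ∀ j, rank j < rank i → a j = b j)))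

/-- An additive embedding of the exponent vectors into a lexicographic product; the order it
induces is `Less` (see `WeightedRevLex.monomialOrder_lt_iff`). -/
def key (lam : Fin n → ℕ) (rank : Equiv.Perm (Fin n)) (a : Fin n →₀ ℕ) :
    ℕ ×ₗ (ℕ ×ₗ Lex (Fin n → ℤ)) :=
  toLex (weight lam a, toLex (totalDegree a, toLex fun p => -(a (rank.symm p) : ℤ)))

theorem key_injective (lam : Fin n → ℕ) (rank : Equiv.Perm (Fin n)) :
    Function.Injective (key lam rank) := by
  intro a b h
  have h1 := congrArg (fun z => ofLex (ofLex (ofLex z).2).2) h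
  ext i
  have h2 := congrFun h1 (rank i)
  simpa [key] using h2

theorem key_add (lam : Fin n → ℕ) (rank : Equiv.Perm (Fin n)) (a b : Fin n →₀ ℕ) :
    key lam rank (a + b) = key lam rank a + key lam rank b := by
  have h1 : weight lam (a + b) = weight lam a + weight lam b := by
    simp [weight, mul_add, Finset.sum_add_distrib]
  have h2 : totalDegree (a + b) = totalDegree a + totalDegree b := by
    simp [totalDegree, Finset.sum_add_distrib]
  have h3 : (fun p => -((a + b) (rank.symm p) : ℤ)) =
      (fun p => -(a (rank.symm p) : ℤ)) + fun p => -(b (rank.symm p) : ℤ) := by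
    funext p
    simp [add_comm]
  unfold key
  rw [h1, h2, h3]
  rfl

theorem key_lt_iff (lam : Fin n → ℕ) (rank : Equiv.Perm (Fin n)) (a b : Fin n →₀ ℕ) :
    key lam rank a < key lam rank b ↔ Less lam rank a b := by
  unfold key Less
  rw [Prod.Lex.toLex_lt_toLex, Prod.Lex.toLex_lt_toLex]
  refine or_congr Iff.rfl (and_congr Iff.rfl (or_congr Iff.rfl (and_congr Iff.rfl ?_)))
  constructor
  · rintro ⟨p, hp, hlt⟩
    refine ⟨rank.symm p, by simpa using hlt, fun j hj => ?_⟩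
    have := hp (rank j) (by simpa using hj)
    simpa using this
  · rintro ⟨i, hi, hj⟩
    refine ⟨rank i, fun p hp => ?_, by simpa using hi⟩
    have := hj (rank.symm p) (by simpa using hp)
    simpa using this

theorem key_monotone (lam : Fin n → ℕ) (rank : Equiv.Perm (Fin n)) {a b : Fin n →₀ ℕ}
    (h : a ≤ b) : key lam rank a ≤ key lam rank b := by
  rcases eq_or_ne a b with rfl | hne
  · exact le_rfl
  apply le_of_lt
  rw [key_lt_iff]
  have hw : weight lam a ≤ weight lam b :=
    Finset.sum_le_sum fun i _ => Nat.mul_le_mul_left _ (h i)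
  have hd : totalDegree a < totalDegree b := by
    apply Finset.sum_lt_sum (fun i _ => h i)
    by_contra hcon
    push Not at hcon
    exact hne (le_antisymm h fun i => hcon i (Finset.mem_univ i))
  rcases hw.lt_or_eq with hw | hw
  · exact Or.inl hw
  · exact Or.inr ⟨hw, Or.inl hd⟩

/-- A copy of the type of exponent vectors, carrying the weighted reverse lexicographic order. -/
@[ext]
structure Syn (lam : Fin n → ℕ) (rank : Equiv.Perm (Fin n)) where
  /-- the underlying exponent vector -/
  exponent : Fin n →₀ ℕ

/-- The identification of exponent vectors with their copy. -/
def synEquiv (lam : Fin n → ℕ) (rank : Equiv.Perm (Fin n)) : Syn lam rank ≃ (Fin n →₀ ℕ) where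
  toFun := Syn.exponent
  invFun := Syn.mk
  left_inv _ := rfl
  right_inv _ := rfl

instance (lam : Fin n → ℕ) (rank : Equiv.Perm (Fin n)) : AddCommMonoid (Syn lam rank) :=
  (synEquiv lam rank).addCommMonoid

instance (lam : Fin n → ℕ) (rank : Equiv.Perm (Fin n)) : LinearOrder (Syn lam rank) :=
  LinearOrder.lift' (fun a => key lam rank a.exponent)
    fun _ _ h => Syn.ext (key_injective lam rank h)

instance (lam : Fin n → ℕ) (rank : Equiv.Perm (Fin n)) :
    IsOrderedAddMonoid (Syn lam rank) where
  add_le_add_left a b h c := by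
    change key lam rank (a.exponent + c.exponent) ≤ key lam rank (b.exponent + c.exponent)
    have h' : key lam rank a.exponent ≤ key lam rank b.exponent := h
    rw [key_add, key_add]
    exact add_le_add_left h' _

instance (lam : Fin n → ℕ) (rank : Equiv.Perm (Fin n)) : WellFoundedLT (Syn lam rank) := by
  have : WellQuasiOrderedLE (Syn lam rank) := ⟨fun s => by
    obtain ⟨i, j, hij, hle⟩ := wellQuasiOrdered_le (α := Fin n →₀ ℕ) fun k => (s k).exponent
    exact ⟨i, j, hij, key_monotone lam rank hle⟩⟩
  infer_instance

/-- The monomial order given by the weight vector `lam`, followed by the reverse lexicographic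
order for the ordering `rank` of the variables. -/
def monomialOrder (lam : Fin n → ℕ) (rank : Equiv.Perm (Fin n)) : MonomialOrder (Fin n) where
  syn := Syn lam rank
  toSyn := { (synEquiv lam rank).symm with map_add' := fun _ _ => rfl }
  toSyn_monotone := fun _ _ h => key_monotone lam rank h

/-- The monomial order just constructed is the explicit comparison `Less`. -/
theorem monomialOrder_lt_iff (lam : Fin n → ℕ) (rank : Equiv.Perm (Fin n))
    (a b : Fin n →₀ ℕ) :
    (monomialOrder lam rank).toSyn a < (monomialOrder lam rank).toSyn b ↔ Less lam rank a b :=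
  key_lt_iff lam rank a b

end WeightedRevLex

/-! ### Initial ideals and Gröbner bases -/

/-- The initial ideal of `I`: the ideal generated by the initial terms of the elements of `I`. -/
def initialIdeal {σ K : Type*} [Field K] (m : MonomialOrder σ) (I : Ideal (MvPolynomial σ K)) :
    Ideal (MvPolynomial σ K) :=
  Ideal.span {t | ∃ f ∈ I, f ≠ 0 ∧ t = m.leadingTerm f}

/-- `G` is a Gröbner basis of `I`: a finite set of nonzero elements of `I` whose initial terms
generate the initial ideal of `I`. -/
structure IsGroebnerBasis {σ K : Type*} [Field K] (m : MonomialOrder σ)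
    (G : Set (MvPolynomial σ K)) (I : Ideal (MvPolynomial σ K)) : Prop where
  finite : G.Finite
  ne_zero : ∀ g ∈ G, g ≠ 0
  mem : ∀ g ∈ G, g ∈ I
  span_leadingTerm : Ideal.span {t | ∃ g ∈ G, t = m.leadingTerm g} = initialIdeal m I

/-! ### Parcycles -/

/-- A parcycle `(C_n, Π)`: a partition `Π` of the vertex set of the `n`-cycle such that each part
induces a connected subgraph. -/
structure Parcycle (n : ℕ) where
  /-- The partition `Π`; its parts are the main vertices. -/
  partition : Finpartition (Finset.univ : Finset (Fin n))
  connected : ∀ V ∈ partition.parts,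
    ((SimpleGraph.cycleGraph n).induce (V : Set (Fin n))).Connected

namespace Parcycle

variable {n : ℕ} (P : Parcycle n)

/-- A parset: a union of parts of the partition. -/
def IsParset (S : Finset (Fin n)) : Prop :=
  ∃ U ⊆ P.partition.parts, S = U.biUnion id

/-- A connected parset: a parset inducing a connected (in particular nonempty) subgraph. -/
def IsConnectedParset (S : Finset (Fin n)) : Prop :=
  P.IsParset S ∧ ((SimpleGraph.cycleGraph n).induce (S : Set (Fin n))).Connected

/-- The vector `b_V`, the sum over `j ∈ V` of the rows of the Laplacian matrix of `C_n`. -/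
def laplacianRow (V : Finset (Fin n)) : Fin n → ℤ :=
  fun i => ∑ j ∈ V, (SimpleGraph.cycleGraph n).lapMatrix ℤ j i

/-- The Laplacian lattice `L_Π`, generated by the vectors `b_V` for the parts `V` of `Π`. -/
def laplacianLattice : AddSubgroup (Fin n → ℤ) :=
  AddSubgroup.closure {b | ∃ V ∈ P.partition.parts, b = laplacianRow V}

variable (K : Type*) [Field K]

/-- The toppling ideal `I_Π`: the lattice ideal of `L_Π`, generated by all `x^u - x^v` with
`u, v ∈ ℕ^n` and `u - v ∈ L_Π`. -/
def topplingIdeal : Ideal (MvPolynomial (Fin n) K) :=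
  Ideal.span {f | ∃ u v : Fin n →₀ ℕ,
    (fun i => (u i : ℤ) - (v i : ℤ)) ∈ P.laplacianLattice ∧
      f = monomial u 1 - monomial v 1}

/-- The monomial `x^{S → S̄}`: the product over `i ∈ S` of `x_i ^ d_i`, where `d_i` is the number
of edges of `C_n` from `i` to the complement of `S`. -/
def cutMonomial (S : Finset (Fin n)) : MvPolynomial (Fin n) K :=
  ∏ i ∈ S, X i ^ (∑ j ∈ Sᶜ, (SimpleGraph.cycleGraph n).adjMatrix ℕ i j)

/-- The binomials `x^{S → S̄} - x^{S̄ → S}`, for `S` a connected parset not containing `Vk`. -/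
def cutBinomials (Vk : Finset (Fin n)) : Set (MvPolynomial (Fin n) K) :=
  {f | ∃ S, P.IsConnectedParset S ∧ ¬ Vk ⊆ S ∧ f = cutMonomial K S - cutMonomial K Sᶜ}

/-- The `G`-parking function ideal `M_Π` with sink `Vk`: generated by the monomials `x^{S → S̄}`,
for `S` a connected parset not containing `Vk`. -/
def parkingIdeal (Vk : Finset (Fin n)) : Ideal (MvPolynomial (Fin n) K) :=
  Ideal.span {f | ∃ S, P.IsConnectedParset S ∧ ¬ Vk ⊆ S ∧ f = cutMonomial K S}

/-- The condition on the weight vector: `b_V · lam > 0` for every part `V` other than `Vk`. -/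
def IsGroebnerWeight (Vk : Finset (Fin n)) (lam : Fin n → ℕ) : Prop :=
  ∀ V ∈ P.partition.parts, V ≠ Vk → 0 < ∑ i, laplacianRow V i * (lam i : ℤ)

end Parcycle

/-! ### Spanning tree orders -/

/-- `j` is a descendant of `i` in the tree `T` rooted at `q`: the path from `q` to `j` passes
through `i` (every vertex is a descendant of itself). -/
def IsDescendant {V : Type*} (T : SimpleGraph V) (q i j : V) : Prop :=
  ∃ p : T.Walk q j, p.IsPath ∧ i ∈ p.support

/-- `T` is a spanning tree of `C_n`, and the ordering `x_i < x_j ↔ rank i < rank j` of the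
variables satisfies `x_i < x_j` whenever `j` is a proper descendant of `i` in `T` rooted
at `q`. -/
structure IsSpanningTreeOrder {n : ℕ} (q : Fin n) (T : SimpleGraph (Fin n))
    (rank : Equiv.Perm (Fin n)) : Prop where
  le_cycle : T ≤ SimpleGraph.cycleGraph n
  isTree : T.IsTree
  rank_lt : ∀ i j, i ≠ j → IsDescendant T q i j → rank i < rank j

end

/-! ### Laplacian matrices and cuts -/

namespace SimpleGraph

variable {V : Type*} [Fintype V] [DecidableEq V] (G : SimpleGraph V) [DecidableRel G.Adj]

/-! The argument compares initial terms directly and needs no S-pairs. Suppose `u - v` lies in the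
lattice, `u ≠ v`, and `u` weighs at least as much as `v`. Write `u - v = ∑ z_V b_V` with `z = 0` at
the sink; this vector is the graph Laplacian of `z`, read as a function on vertices. If `z ≤ 0`
everywhere, positivity of `b_V · λ` off the sink forces `z = 0` and `u = v`. So `max z > 0`, and the
vertices where `z` is maximal form a parset avoiding the sink. Across each edge leaving it `z` drops
by at least one, so a connected component `S` of it satisfies `x^{S → S̄} ∣ x^u`
(`exists_cutExponent_le`).

An element of the toppling ideal has coefficient sum zero on each class modulo the lattice
(`sum_coeff_eq_zero_of_mem_topplingIdeal`), so its initial exponent is congruent to a smaller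
exponent in its support. Hence every initial term lies in the parking ideal. Conversely, the cut
binomials lie in the toppling ideal with initial term `x^{S → S̄}`, because the weights of their two
terms differ by `b_S · λ > 0`. -/

theorem sum_mul_lapMatrix (f : V → ℤ) (i : V) :
    ∑ j, f j * G.lapMatrix ℤ j i = ∑ j, if G.Adj i j then f i - f j else 0 := by
  have h1 : ∑ j, f j * G.lapMatrix ℤ j i = (G.lapMatrix ℤ).mulVec f i := by
    simp only [Matrix.mulVec, dotProduct]
    refine Finset.sum_congr rfl fun j _ => ?_
    rw [mul_comm, (G.isSymm_lapMatrix (R := ℤ)).apply]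
  rw [h1, lapMatrix_mulVec_apply, degree_eq_sum_if_adj, Finset.sum_mul,
    neighborFinset_eq_filter, Finset.sum_filter, ← Finset.sum_sub_distrib]
  refine Finset.sum_congr rfl fun j _ => ?_
  split_ifs <;> simp

end SimpleGraph

namespace Parcycle

variable {n : ℕ} (P : Parcycle n)

/-- By symmetry of the Laplacian, `b_S` is the Laplacian of the indicator function of `S`; only
edges of the cut contribute. -/
theorem laplacianRow_apply (S : Finset (Fin n)) (i : Fin n) :
    laplacianRow S i = ∑ j, if (SimpleGraph.cycleGraph n).Adj i j then
      ((if i ∈ S then 1 else 0) - (if j ∈ S then 1 else 0) : ℤ) else 0 := by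
  rw [← SimpleGraph.sum_mul_lapMatrix _ (fun j => if j ∈ S then (1 : ℤ) else 0)]
  simp [laplacianRow]

/-- The exponent vector of the monomial `x^{S → S̄}`. -/
noncomputable def cutExponent (S : Finset (Fin n)) : Fin n →₀ ℕ :=
  Finsupp.equivFunOnFinite.symm fun i =>
    if i ∈ S then ∑ j ∈ Sᶜ, (SimpleGraph.cycleGraph n).adjMatrix ℕ i j else 0

theorem cutExponent_apply (S : Finset (Fin n)) (i : Fin n) :
    cutExponent S i =
      if i ∈ S then ∑ j ∈ Sᶜ, (SimpleGraph.cycleGraph n).adjMatrix ℕ i j else 0 := rfl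

theorem cutMonomial_eq_monomial (K : Type*) [Field K] (S : Finset (Fin n)) :
    cutMonomial K S = monomial (cutExponent S) 1 := by
  rw [monomial_eq, map_one, one_mul, Finsupp.prod_fintype _ _ (by simp)]
  simp only [cutExponent_apply, cutMonomial, pow_ite, pow_zero]
  rw [Finset.prod_ite_mem, Finset.univ_inter]

/-- Cut edges count positively at their end in `S` and negatively at the other end, so the two cut
monomials are the positive and negative parts of `b_S`. -/
theorem cutExponent_sub_compl (S : Finset (Fin n)) (i : Fin n) :
    (cutExponent S i : ℤ) - cutExponent Sᶜ i = laplacianRow S i := by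
  rw [laplacianRow_apply]
  by_cases hi : i ∈ S
  · simp only [cutExponent_apply, hi, Finset.mem_compl, if_true, not_true_eq_false, if_false,
      SimpleGraph.adjMatrix_apply]
    push_cast
    rw [sub_zero, ← Finset.sum_filter_add_sum_filter_not Finset.univ (· ∈ S),
      Finset.sum_eq_zero (s := Finset.univ.filter (· ∈ S)), zero_add]
    · refine Finset.sum_congr (by ext; simp) fun j hj => ?_
      rw [Finset.mem_filter] at hj
      simp [hj.2]
    · intro j hj
      rw [Finset.mem_filter] at hj
      simp [hj.2]
  · simp only [cutExponent_apply, hi, Finset.mem_compl, if_true, not_false_eq_true, if_false,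
      SimpleGraph.adjMatrix_apply, compl_compl]
    push_cast
    rw [zero_sub, ← Finset.sum_filter_add_sum_filter_not Finset.univ (· ∈ S), add_comm,
      Finset.sum_eq_zero (s := Finset.univ.filter (· ∉ S)), zero_add, ← Finset.sum_neg_distrib]
    · refine Finset.sum_congr (by ext; simp) fun j hj => ?_
      split_ifs <;> simp_all
    · intro j hj
      rw [Finset.mem_filter] at hj
      simp [hj.2]

theorem laplacianRow_biUnion {U : Finset (Finset (Fin n))} (hU : U ⊆ P.partition.parts) :
    laplacianRow (U.biUnion id) = ∑ V ∈ U, laplacianRow V := by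
  funext i
  rw [Finset.sum_apply]
  unfold laplacianRow
  rw [Finset.sum_biUnion (P.partition.disjoint.subset hU)]
  rfl

/-- Constants lie in the kernel of the Laplacian. This relation allows the sink coefficient to be
normalised to zero. -/
theorem sum_laplacianRow : ∑ V ∈ P.partition.parts, laplacianRow V = 0 := by
  rw [← P.laplacianRow_biUnion subset_rfl, P.partition.biUnion_parts]
  funext i
  simp [laplacianRow_apply]

theorem laplacianRow_mem_laplacianLattice {S : Finset (Fin n)} (hS : P.IsParset S) :
    laplacianRow S ∈ P.laplacianLattice := by
  obtain ⟨U, hU, rfl⟩ := hS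
  rw [P.laplacianRow_biUnion hU]
  exact sum_mem fun V hV => AddSubgroup.subset_closure ⟨V, hU hV, rfl⟩

theorem isParset_of_forall_part {S : Finset (Fin n)}
    (h : ∀ V ∈ P.partition.parts, ∀ i ∈ V, i ∈ S → V ⊆ S) : P.IsParset S := by
  refine ⟨P.partition.parts.filter (· ⊆ S), Finset.filter_subset _ _, ?_⟩
  ext i
  simp only [Finset.mem_biUnion, Finset.mem_filter, id]
  constructor
  · intro hi
    have hm := P.partition.part_mem.2 (Finset.mem_univ i)
    have hs := P.partition.mem_part (Finset.mem_univ i)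
    exact ⟨_, ⟨hm, h _ hm i hs hi⟩, hs⟩
  · rintro ⟨V, ⟨-, hV⟩, hi⟩
    exact hV hi

variable {P}

/-- A Gröbner weight is positive on `b_S` for every nonempty parset `S` avoiding the sink. -/
theorem IsGroebnerWeight.sum_laplacianRow_pos {Vk : Finset (Fin n)} {lam : Fin n → ℕ}
    (hlam : P.IsGroebnerWeight Vk lam) {S : Finset (Fin n)} (hS : P.IsParset S)
    (hne : S.Nonempty) (hVk : ¬ Vk ⊆ S) : 0 < ∑ i, laplacianRow S i * (lam i : ℤ) := by
  obtain ⟨U, hU, rfl⟩ := hS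
  rw [P.laplacianRow_biUnion hU]
  simp only [Finset.sum_apply, Finset.sum_mul]
  rw [Finset.sum_comm]
  refine Finset.sum_pos (fun V hV => hlam V (hU hV) ?_) ?_
  · rintro rfl
    exact hVk (Finset.subset_biUnion_of_mem id hV)
  · obtain ⟨i, hi⟩ := hne
    obtain ⟨V, hV, -⟩ := Finset.mem_biUnion.1 hi
    exact ⟨V, hV⟩

theorem IsConnectedParset.nonempty {S : Finset (Fin n)} (hS : P.IsConnectedParset S) :
    S.Nonempty := by
  obtain ⟨⟨i, hi⟩⟩ := hS.2.nonempty
  exact ⟨i, hi⟩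

/-! ### Lattice vectors as Laplacians, and divisibility by cut monomials -/

variable (P)

/-- Lattice elements are integer combinations of the `b_V`, in which the coefficient of one
chosen part may be taken to be zero. -/
theorem exists_coeff_of_mem_laplacianLattice {Vk : Finset (Fin n)} {b : Fin n → ℤ}
    (hb : b ∈ P.laplacianLattice) :
    ∃ z : Finset (Fin n) → ℤ, z Vk = 0 ∧ b = ∑ V ∈ P.partition.parts, z V • laplacianRow V := by
  suffices h : ∃ z : Finset (Fin n) → ℤ, b = ∑ V ∈ P.partition.parts, z V • laplacianRow V by
    obtain ⟨z, rfl⟩ := h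
    refine ⟨fun V => z V - z Vk, sub_self _, ?_⟩
    simp only [sub_smul, Finset.sum_sub_distrib, ← Finset.smul_sum, P.sum_laplacianRow,
      smul_zero, sub_zero]
  induction hb using AddSubgroup.closure_induction with
  | mem x hx =>
    obtain ⟨V, hV, rfl⟩ := hx
    refine ⟨fun W => if W = V then 1 else 0, ?_⟩
    simp [ite_smul, hV]
  | zero => exact ⟨0, by simp⟩
  | add x y _ _ hx hy =>
    obtain ⟨z, rfl⟩ := hx
    obtain ⟨w, rfl⟩ := hy
    exact ⟨z + w, by simp [add_smul, Finset.sum_add_distrib]⟩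
  | neg x _ hx =>
    obtain ⟨z, rfl⟩ := hx
    exact ⟨-z, by simp⟩

/-- Writing the combination through differences across edges makes a maximum argument on `z`
possible. -/
theorem sum_smul_laplacianRow_apply (z : Finset (Fin n) → ℤ) (i : Fin n) :
    (∑ V ∈ P.partition.parts, z V • laplacianRow V) i =
      ∑ j, if (SimpleGraph.cycleGraph n).Adj i j then
        z (P.partition.part i) - z (P.partition.part j) else 0 := by
  have hsum : ∀ g : Fin n → ℤ, ∑ j, g j = ∑ V ∈ P.partition.parts, ∑ j ∈ V, g j := fun g => by
    conv_lhs => rw [← P.partition.sup_parts, Finset.sup_eq_biUnion]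
    exact Finset.sum_biUnion P.partition.disjoint
  rw [← SimpleGraph.sum_mul_lapMatrix _ (fun j => z (P.partition.part j)), hsum,
    Finset.sum_apply]
  refine Finset.sum_congr rfl fun V hV => ?_
  rw [Pi.smul_apply, laplacianRow, smul_eq_mul, Finset.mul_sum]
  refine Finset.sum_congr rfl fun j hj => ?_
  rw [P.partition.part_eq_of_mem hV hj]

/-- A parset is the disjoint union of connected parsets with no edges between them: every vertex
lies in such a connected piece. -/
theorem exists_isConnectedParset_subset {S : Finset (Fin n)} {i : Fin n} (hi : i ∈ S)
    (hS : ∀ V ∈ P.partition.parts, ∀ i ∈ V, i ∈ S → V ⊆ S) :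
    ∃ S' ⊆ S, P.IsConnectedParset S' ∧
      ∀ a ∈ S', ∀ b ∈ S, (SimpleGraph.cycleGraph n).Adj a b → b ∈ S' := by
  classical
  set G := SimpleGraph.cycleGraph n
  -- The component of `i` in the subgraph induced on `S`. It is a union of parts because each part
  -- is connected.
  let S' : Finset (Fin n) := Finset.univ.filter fun a => ∃ h : a ∈ S,
    (G.induce (S : Set (Fin n))).Reachable ⟨i, hi⟩ ⟨a, h⟩
  have hmem : ∀ a, a ∈ S' ↔ ∃ h : a ∈ S,
      (G.induce (S : Set (Fin n))).Reachable ⟨i, hi⟩ ⟨a, h⟩ := fun a => by simp [S']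
  refine ⟨S', fun a ha => ((hmem a).1 ha).1, ⟨?_, ?_⟩, ?_⟩
  · refine P.isParset_of_forall_part fun V hV a haV haS' b hbV => ?_
    obtain ⟨haS, hr⟩ := (hmem a).1 haS'
    have hVS := hS V hV a haV haS
    refine (hmem b).2 ⟨hVS hbV, hr.trans ?_⟩
    have := (P.connected V hV).preconnected ⟨a, haV⟩ ⟨b, hbV⟩
    exact this.map (SimpleGraph.induceHomOfLE G (Finset.coe_subset.2 hVS)).toHom
  -- A walk in `S` that starts in the component never leaves it, so it is also a walk in the graph
  -- induced on `S'`.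
  · have key : ∀ x y : (S : Set (Fin n)), (G.induce (S : Set (Fin n))).Walk x y →
        ∀ (hx : x.1 ∈ S') (hy : y.1 ∈ S'),
          (G.induce (S' : Set (Fin n))).Reachable ⟨x.1, hx⟩ ⟨y.1, hy⟩ := by
      intro x y p
      induction p with
      | nil => intro _ _; exact SimpleGraph.Reachable.refl _
      | @cons u v w h p ih =>
        intro hx hy
        obtain ⟨hu, hr⟩ := (hmem u.1).1 hx
        have hv : v.1 ∈ S' := (hmem _).2 ⟨v.2, hr.trans h.reachable⟩
        have hadj : (G.induce (S' : Set (Fin n))).Adj ⟨u.1, hx⟩ ⟨v.1, hv⟩ := h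
        exact hadj.reachable.trans (ih hv hy)
    have hi' : i ∈ S' := (hmem i).2 ⟨hi, SimpleGraph.Reachable.refl _⟩
    have : Nonempty (S' : Set (Fin n)) := ⟨⟨i, hi'⟩⟩
    refine SimpleGraph.Connected.mk fun x y => ?_
    have hx := (hmem x.1).1 x.2
    have hy := (hmem y.1).1 y.2
    obtain ⟨hxS, hxr⟩ := hx
    obtain ⟨hyS, hyr⟩ := hy
    obtain ⟨p⟩ := hxr.symm.trans hyr
    exact key _ _ p x.2 y.2
  · intro a ha b hb hab
    obtain ⟨haS, hr⟩ := (hmem a).1 ha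
    have : (G.induce (S : Set (Fin n))).Adj ⟨a, haS⟩ ⟨b, hb⟩ := hab
    exact (hmem b).2 ⟨hb, hr.trans this.reachable⟩

/-- If `x^v < x^u` are congruent modulo the Laplacian lattice, then `x^u` is divisible by a cut
monomial of a connected parset avoiding the sink. -/
theorem exists_cutExponent_le {Vk : Finset (Fin n)} (hVk : Vk ∈ P.partition.parts)
    {lam : Fin n → ℕ} (hlam : P.IsGroebnerWeight Vk lam) {u v : Fin n →₀ ℕ} (hne : u ≠ v)
    (huv : (fun i => (u i : ℤ) - (v i : ℤ)) ∈ P.laplacianLattice)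
    (hw : WeightedRevLex.weight lam v ≤ WeightedRevLex.weight lam u) :
    ∃ S, P.IsConnectedParset S ∧ ¬ Vk ⊆ S ∧ cutExponent S ≤ u := by
  obtain ⟨z, hz, hb⟩ := P.exists_coeff_of_mem_laplacianLattice (Vk := Vk) huv
  obtain ⟨W, hW, hmax⟩ := P.partition.parts.exists_max_image z ⟨Vk, hVk⟩
  by_cases hpos : 0 < z W
  · obtain ⟨i, hi⟩ := P.partition.nonempty_of_mem_parts hW
    let S := Finset.univ.filter fun i => z (P.partition.part i) = z W
    have hmem : ∀ a, a ∈ S ↔ z (P.partition.part a) = z W := fun a => by simp [S]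
    have hle : ∀ a, z (P.partition.part a) ≤ z W := fun a =>
      hmax _ (P.partition.part_mem.2 (Finset.mem_univ a))
    have hiS : i ∈ S := (hmem i).2 (by rw [P.partition.part_eq_of_mem hW hi])
    obtain ⟨S', hS', hcon, hcl⟩ := P.exists_isConnectedParset_subset hiS
      fun V hV a haV haS b hbV => by
        rw [hmem, P.partition.part_eq_of_mem hV haV] at haS
        rwa [hmem, P.partition.part_eq_of_mem hV hbV]
    refine ⟨S', hcon, fun hsub => ?_, fun a => ?_⟩
    · obtain ⟨q, hq⟩ := P.partition.nonempty_of_mem_parts hVk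
      have := (hmem q).1 (hS' (hsub hq))
      rw [P.partition.part_eq_of_mem hVk hq] at this
      omega
    · rw [cutExponent_apply]
      split_ifs with ha
      swap
      · exact Nat.zero_le _
      have haS := (hmem a).1 (hS' ha)
      have h1 : (u a : ℤ) - v a = _ := congrFun hb a
      rw [P.sum_smul_laplacianRow_apply, haS] at h1
      -- A neighbour of `a` outside the component is outside the whole maximal set, so the integer
      -- `z` drops by at least one there. All other edges contribute nonnegatively.
      have h2 : ((∑ j ∈ S'ᶜ, (SimpleGraph.cycleGraph n).adjMatrix ℕ a j : ℕ) : ℤ) ≤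
          ∑ j, if (SimpleGraph.cycleGraph n).Adj a j then
            z W - z (P.partition.part j) else 0 := by
        push_cast
        refine le_trans (Finset.sum_le_sum fun j hj => ?_)
          (Finset.sum_le_sum_of_subset_of_nonneg (Finset.subset_univ S'ᶜ) fun j _ _ => ?_)
        · rw [SimpleGraph.adjMatrix_apply]
          split_ifs with hadj
          · have hjS : ¬ z (P.partition.part j) = z W := fun h =>
              Finset.mem_compl.1 hj (hcl a ha j ((hmem j).2 h) hadj)
            have := hle j
            push_cast
            omega
          · simp
        · have := hle j
          split_ifs <;> omega
      omega
  · exfalso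
    have hneg : ∀ V ∈ P.partition.parts, z V ≤ 0 := fun V hV => by
      have := hmax V hV
      omega
    have hsum : (WeightedRevLex.weight lam u : ℤ) - WeightedRevLex.weight lam v =
        ∑ V ∈ P.partition.parts, z V * ∑ i, laplacianRow V i * (lam i : ℤ) := by
      have h1 : (WeightedRevLex.weight lam u : ℤ) - WeightedRevLex.weight lam v =
          ∑ i, ((u i : ℤ) - v i) * lam i := by
        simp only [WeightedRevLex.weight]
        push_cast
        rw [← Finset.sum_sub_distrib]
        exact Finset.sum_congr rfl fun i _ => by ring
      rw [h1]
      simp only [Finset.mul_sum]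
      rw [Finset.sum_comm]
      refine Finset.sum_congr rfl fun i _ => ?_
      have h2 : (u i : ℤ) - v i = _ := congrFun hb i
      rw [h2, Finset.sum_apply, Finset.sum_mul]
      exact Finset.sum_congr rfl fun V _ => by simp [mul_assoc]
    have hterm : ∀ V ∈ P.partition.parts,
        z V * ∑ i, laplacianRow V i * (lam i : ℤ) ≤ 0 := fun V hV => by
      rcases eq_or_ne V Vk with rfl | h
      · simp [hz]
      · exact mul_nonpos_of_nonpos_of_nonneg (hneg V hV) (hlam V hV h).le
    have hzero : ∀ V ∈ P.partition.parts,
        z V * ∑ i, laplacianRow V i * (lam i : ℤ) = 0 := by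
      refine (Finset.sum_eq_zero_iff_of_nonpos hterm).1 (le_antisymm (Finset.sum_nonpos hterm) ?_)
      rw [← hsum]
      omega
    have hz0 : ∀ V ∈ P.partition.parts, z V = 0 := fun V hV => by
      rcases eq_or_ne V Vk with rfl | h
      · exact hz
      · exact (mul_eq_zero.1 (hzero V hV)).resolve_right (hlam V hV h).ne'
    apply hne
    ext i
    have h2 : (u i : ℤ) - v i = _ := congrFun hb i
    rw [Finset.sum_eq_zero fun V hV => by rw [hz0 V hV, zero_smul]] at h2
    have h3 : (0 : Fin n → ℤ) i = 0 := rfl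
    omega

/-! ### The toppling ideal -/

/-- The coefficients of an element of a lattice ideal sum to zero over each class of exponent
vectors modulo the lattice. -/
theorem sum_coeff_eq_zero_of_mem_topplingIdeal (K : Type*) [Field K]
    {f : MvPolynomial (Fin n) K} (hf : f ∈ P.topplingIdeal K) (u : Fin n →₀ ℕ)
    [DecidablePred fun v : Fin n →₀ ℕ =>
      (fun i => (u i : ℤ) - (v i : ℤ)) ∈ P.laplacianLattice] :
    ∑ v ∈ f.support with (fun i => (u i : ℤ) - (v i : ℤ)) ∈ P.laplacianLattice,
      f.coeff v = 0 := by
  let r : (Fin n →₀ ℕ) → Prop := fun v => (fun i => (u i : ℤ) - (v i : ℤ)) ∈ P.laplacianLattice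
  -- The linear functional summing the coefficients over the class of `u`.
  let φ : MvPolynomial (Fin n) K →ₗ[K] K :=
    (MvPolynomial.basisMonomials (Fin n) K).constr K fun v => if r v then 1 else 0
  have hφm : ∀ (v : Fin n →₀ ℕ) (c : K), φ (monomial v c) = if r v then c else 0 := by
    intro v c
    have h1 : φ (monomial v 1) = if r v then 1 else 0 := by
      have := (MvPolynomial.basisMonomials (Fin n) K).constr_basis K
        (fun v => if r v then (1 : K) else 0) v
      rwa [coe_basisMonomials] at this
    have h2 : (monomial v c : MvPolynomial (Fin n) K) = c • monomial v 1 := by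
      rw [smul_monomial, smul_eq_mul, mul_one]
    rw [h2, map_smul, h1]
    split_ifs <;> simp
  have hφ : φ f = ∑ v ∈ f.support with r v, f.coeff v := by
    conv_lhs => rw [f.as_sum, map_sum]
    simp only [hφm]
    rw [Finset.sum_filter]
  change ∑ v ∈ f.support with r v, f.coeff v = 0
  rw [← hφ]
  have hspan : ∀ g : MvPolynomial (Fin n) K, ∀ a b : Fin n →₀ ℕ,
      (fun i => (a i : ℤ) - (b i : ℤ)) ∈ P.laplacianLattice →
        φ (g * (monomial a 1 - monomial b 1)) = 0 := by
    intro g a b hab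
    induction g using MvPolynomial.induction_on' with
    | monomial w c =>
      rw [mul_sub, monomial_mul, monomial_mul, mul_one, map_sub, hφm, hφm]
      -- Multiplying a generator by a monomial keeps its two terms congruent, so their contributions
      -- cancel.
      have : r (w + a) ↔ r (w + b) := by
        have e : (fun i => (u i : ℤ) - ((w + b) i : ℕ)) =
            (fun i => (u i : ℤ) - ((w + a) i : ℕ)) + fun i => (a i : ℤ) - (b i : ℤ) := by
          funext i
          simp only [Pi.add_apply, Finsupp.add_apply]
          push_cast
          ring
        change _ ∈ P.laplacianLattice ↔ _ ∈ P.laplacianLattice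
        rw [e]
        exact (AddSubgroup.add_mem_cancel_right _ hab).symm
      simp [this]
    | add p q hp hq => rw [add_mul, map_add, hp, hq, add_zero]
  -- The kernel of `φ` need not be an ideal; allowing an arbitrary multiplier `g` makes the
  -- induction pass through scalar multiples.
  suffices h : ∀ g, φ (g * f) = 0 by simpa using h 1
  unfold topplingIdeal at hf
  clear hφ
  induction hf using Submodule.span_induction with
  | mem x hx =>
    obtain ⟨a, b, hab, rfl⟩ := hx
    exact fun g => hspan g a b hab
  | zero => simp
  | add x y _ _ hx hy => exact fun g => by rw [mul_add, map_add, hx, hy, add_zero]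
  | smul p x _ hx => exact fun g => by rw [smul_eq_mul, ← mul_assoc, hx]

theorem cutMonomial_sub_mem_topplingIdeal (K : Type*) [Field K] {S : Finset (Fin n)}
    (hS : P.IsParset S) : cutMonomial K S - cutMonomial K Sᶜ ∈ P.topplingIdeal K := by
  refine Ideal.subset_span ⟨cutExponent S, cutExponent Sᶜ, ?_, ?_⟩
  · rw [funext (cutExponent_sub_compl S)]
    exact P.laplacianRow_mem_laplacianLattice hS
  · rw [cutMonomial_eq_monomial, cutMonomial_eq_monomial]

/-! ### Initial terms and the Gröbner basis -/

variable {P}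

theorem cutExponent_compl_lt {Vk : Finset (Fin n)} {lam : Fin n → ℕ}
    (hlam : P.IsGroebnerWeight Vk lam) (rank : Equiv.Perm (Fin n)) {S : Finset (Fin n)}
    (hS : P.IsConnectedParset S) (hVk : ¬ Vk ⊆ S) :
    (WeightedRevLex.monomialOrder lam rank).toSyn (cutExponent Sᶜ) <
      (WeightedRevLex.monomialOrder lam rank).toSyn (cutExponent S) := by
  rw [WeightedRevLex.monomialOrder_lt_iff]
  left
  have h := hlam.sum_laplacianRow_pos hS.1 hS.nonempty hVk
  zify
  rw [← sub_pos]
  convert h using 1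
  simp only [WeightedRevLex.weight]
  push_cast
  rw [← Finset.sum_sub_distrib]
  refine Finset.sum_congr rfl fun i _ => ?_
  rw [← cutExponent_sub_compl]
  ring

theorem leadingTerm_cutMonomial_sub (K : Type*) [Field K] {Vk : Finset (Fin n)} {lam : Fin n → ℕ}
    (hlam : P.IsGroebnerWeight Vk lam) (rank : Equiv.Perm (Fin n)) {S : Finset (Fin n)}
    (hS : P.IsConnectedParset S) (hVk : ¬ Vk ⊆ S) :
    (WeightedRevLex.monomialOrder lam rank).leadingTerm (cutMonomial K S - cutMonomial K Sᶜ) =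
      cutMonomial K S := by
  classical
  have hlt := cutExponent_compl_lt hlam rank hS hVk
  have hdeg : ∀ u : Fin n →₀ ℕ, (WeightedRevLex.monomialOrder lam rank).degree
      (monomial u (1 : K)) = u := fun u => by
    rw [MonomialOrder.degree_monomial, if_neg one_ne_zero]
  have h : (WeightedRevLex.monomialOrder lam rank).toSyn
      ((WeightedRevLex.monomialOrder lam rank).degree (cutMonomial K Sᶜ)) <
      (WeightedRevLex.monomialOrder lam rank).toSyn
        ((WeightedRevLex.monomialOrder lam rank).degree (cutMonomial K S)) := by
    rwa [cutMonomial_eq_monomial, cutMonomial_eq_monomial, hdeg, hdeg]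
  rw [MonomialOrder.leadingTerm, MonomialOrder.degree_sub_of_lt h,
    MonomialOrder.leadingCoeff_sub_of_lt h, cutMonomial_eq_monomial, hdeg,
    MonomialOrder.leadingCoeff_monomial]

theorem leadingTerm_mem_parkingIdeal {K : Type*} [Field K] {Vk : Finset (Fin n)}
    (hVk : Vk ∈ P.partition.parts) {lam : Fin n → ℕ} (hlam : P.IsGroebnerWeight Vk lam)
    (rank : Equiv.Perm (Fin n)) {f : MvPolynomial (Fin n) K} (hf : f ∈ P.topplingIdeal K)
    (hf0 : f ≠ 0) :
    (WeightedRevLex.monomialOrder lam rank).leadingTerm f ∈ P.parkingIdeal K Vk := by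
  classical
  set m := WeightedRevLex.monomialOrder lam rank with hm
  have hu := m.degree_mem_support hf0
  have hsum := P.sum_coeff_eq_zero_of_mem_topplingIdeal K hf (m.degree f)
  obtain ⟨v, hv, hne⟩ : ∃ v ∈ f.support.filter fun v =>
      (fun i => (m.degree f i : ℤ) - (v i : ℤ)) ∈ P.laplacianLattice, v ≠ m.degree f := by
    -- If the initial exponent were alone in its class, the vanishing class sum would be the leading
    -- coefficient.
    by_contra! hcon
    have hmem : m.degree f ∈ f.support.filter fun v =>
        (fun i => (m.degree f i : ℤ) - (v i : ℤ)) ∈ P.laplacianLattice := by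
      rw [Finset.mem_filter]
      refine ⟨hu, ?_⟩
      simp only [sub_self]
      exact zero_mem _
    rw [Finset.sum_eq_single_of_mem _ hmem fun v hv hne => absurd (hcon v hv) hne] at hsum
    exact (mem_support_iff.1 hu) hsum
  rw [Finset.mem_filter] at hv
  have hlt : m.toSyn v < m.toSyn (m.degree f) :=
    lt_of_le_of_ne (m.le_degree hv.1) fun h => hne (m.toSyn.injective h)
  have hw : WeightedRevLex.weight lam v ≤ WeightedRevLex.weight lam (m.degree f) := by
    rw [hm, WeightedRevLex.monomialOrder_lt_iff] at hlt
    rcases hlt with h | h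
    · exact h.le
    · exact h.1.le
  obtain ⟨S, hS, hSk, hle⟩ := P.exists_cutExponent_le hVk hlam hne.symm hv.2 hw
  have hgen : cutMonomial K S ∈ P.parkingIdeal K Vk := Ideal.subset_span ⟨S, hS, hSk, rfl⟩
  have : m.leadingTerm f =
      monomial (m.degree f - cutExponent S) (m.leadingCoeff f) * cutMonomial K S := by
    rw [cutMonomial_eq_monomial, monomial_mul, tsub_add_cancel_of_le hle, mul_one,
      MonomialOrder.leadingTerm]
  rw [this]
  exact Ideal.mul_mem_left _ _ hgen

theorem initialIdeal_topplingIdeal (K : Type*) [Field K] {Vk : Finset (Fin n)}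
    (hVk : Vk ∈ P.partition.parts) {lam : Fin n → ℕ} (hlam : P.IsGroebnerWeight Vk lam)
    (rank : Equiv.Perm (Fin n)) :
    initialIdeal (WeightedRevLex.monomialOrder lam rank) (P.topplingIdeal K) =
      P.parkingIdeal K Vk := by
  apply le_antisymm
  · rw [initialIdeal, Ideal.span_le]
    rintro _ ⟨f, hf, hf0, rfl⟩
    exact leadingTerm_mem_parkingIdeal hVk hlam rank hf hf0
  · rw [parkingIdeal, Ideal.span_le]
    rintro _ ⟨S, hS, hSk, rfl⟩
    have hlt := leadingTerm_cutMonomial_sub K hlam rank hS hSk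
    refine Ideal.subset_span ⟨_, P.cutMonomial_sub_mem_topplingIdeal K hS.1, ?_, hlt.symm⟩
    intro h0
    rw [h0, MonomialOrder.leadingTerm_zero, cutMonomial_eq_monomial] at hlt
    exact one_ne_zero (monomial_eq_zero.1 hlt.symm)

theorem isGroebnerBasis_cutBinomials (K : Type*) [Field K] {Vk : Finset (Fin n)}
    (hVk : Vk ∈ P.partition.parts) {lam : Fin n → ℕ} (hlam : P.IsGroebnerWeight Vk lam)
    (rank : Equiv.Perm (Fin n)) :
    IsGroebnerBasis (WeightedRevLex.monomialOrder lam rank)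
      (P.cutBinomials K Vk) (P.topplingIdeal K) where
  finite := by
    refine (Set.finite_range fun S : Finset (Fin n) =>
      cutMonomial K S - cutMonomial K Sᶜ).subset ?_
    rintro _ ⟨S, -, -, rfl⟩
    exact ⟨S, rfl⟩
  ne_zero := by
    rintro _ ⟨S, hS, hSk, rfl⟩ h0
    have hlt := leadingTerm_cutMonomial_sub K hlam rank hS hSk
    rw [h0, MonomialOrder.leadingTerm_zero, cutMonomial_eq_monomial] at hlt
    exact one_ne_zero (monomial_eq_zero.1 hlt.symm)
  mem := by
    rintro _ ⟨S, hS, -, rfl⟩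
    exact P.cutMonomial_sub_mem_topplingIdeal K hS.1
  span_leadingTerm := by
    rw [initialIdeal_topplingIdeal K hVk hlam rank, parkingIdeal]
    congr 1
    ext t
    constructor
    · rintro ⟨_, ⟨S, hS, hSk, rfl⟩, rfl⟩
      exact ⟨S, hS, hSk, leadingTerm_cutMonomial_sub K hlam rank hS hSk⟩
    · rintro ⟨S, hS, hSk, rfl⟩
      exact ⟨_, ⟨S, hS, hSk, rfl⟩, (leadingTerm_cutMonomial_sub K hlam rank hS hSk).symm⟩

/-! ### Existence of weights and of spanning tree orders -/

/-- The weight `t (n - t)`, where `t` is the position counted from `q` along the cycle, has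
Laplacian `2` away from `q`. -/
theorem exists_isGroebnerWeight (hn : 3 ≤ n) (P : Parcycle n) {Vk : Finset (Fin n)}
    (hVk : Vk ∈ P.partition.parts) {q : Fin n} (hq : q ∈ Vk) :
    ∃ lam : Fin n → ℕ, P.IsGroebnerWeight Vk lam := by
  obtain ⟨m, rfl⟩ := Nat.exists_eq_add_of_le' hn
  let lam : Fin (m + 3) → ℕ := fun i => (i - q).val * (m + 3 - (i - q).val)
  have hlap : ∀ j, j ≠ q →
      ((SimpleGraph.cycleGraph (m + 3)).lapMatrix ℤ).mulVec (fun i => (lam i : ℤ)) j = 2 := by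
    intro j hj
    have hs0 : j - q ≠ 0 := sub_ne_zero.2 hj
    have hcast : ∀ i, (lam i : ℤ) = (i - q).val * (m + 3 - (i - q).val : ℤ) := fun i => by
      have := (i - q).isLt
      simp only [lam]
      push_cast [Nat.cast_sub this.le]
      ring
    have hsub : (j - 1 - q).val = (j - q).val - 1 := by
      rw [sub_right_comm, Fin.val_sub_one_of_ne_zero hs0]
    have hpos : 0 < (j - q).val := Fin.pos_iff_ne_zero.2 hs0
    have hadd : (lam (j + 1) : ℤ) = ((j - q).val + 1) * (m + 2 - (j - q).val : ℤ) := by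
      rw [hcast, add_sub_right_comm]
      -- If `j` is the last vertex before `q`, then `j + 1` wraps around to `q`; the formula
      -- survives because both sides vanish.
      rcases eq_or_ne (j - q) (Fin.last (m + 2)) with h | h
      · simp [h]
      · rw [Fin.val_add_one_of_lt (lt_of_le_of_ne (Fin.le_last _) h)]
        push_cast
        ring
    rw [SimpleGraph.lapMatrix_mulVec_apply, SimpleGraph.cycleGraph_neighborFinset,
      SimpleGraph.cycleGraph_degree_three_le, Finset.sum_pair, hadd, hcast j, hcast (j - 1), hsub]
    · push_cast [Nat.cast_sub (Nat.one_le_of_lt hpos)]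
      ring
    -- The neighbours `j - 1` and `j + 1` are distinct, since `2 ≠ 0` modulo `m + 3`.
    · intro h
      have h2 : (1 : Fin (m + 3)) + 1 = 0 := by
        have := congrArg (fun x => x - j + 1) h
        simpa using this.symm
      have := congrArg Fin.val h2
      simp only [Fin.val_add, Fin.val_one, Fin.val_zero] at this
      rw [Nat.mod_eq_of_lt (by omega)] at this
      omega
  refine ⟨lam, fun V hV hne => ?_⟩
  have hqV : q ∉ V := fun h => hne (P.partition.eq_of_mem_parts hV hVk h hq)
  have hsum : ∑ i, laplacianRow V i * (lam i : ℤ) = ∑ j ∈ V, 2 := by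
    simp only [laplacianRow, Finset.sum_mul]
    rw [Finset.sum_comm]
    exact Finset.sum_congr rfl fun j hj => hlap j (ne_of_mem_of_not_mem hj hqV)
  rw [hsum]
  exact Finset.sum_pos (fun _ _ => two_pos) (P.partition.nonempty_of_mem_parts hV)

end Parcycle

/-- Paths in a tree are unique, so the path through `i` is a geodesic, and its initial segment
ending at `i` is strictly shorter. -/
theorem IsDescendant.dist_lt {V : Type*} {T : SimpleGraph V} (hT : T.IsTree) {q i j : V}
    (hij : i ≠ j) (h : IsDescendant T q i j) : T.dist q i < T.dist q j := by
  classical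
  obtain ⟨p, hp, hi⟩ := h
  obtain ⟨p', hp', hlen⟩ := hT.connected.exists_path_of_dist q j
  have : p = p' := congrArg Subtype.val
    ((hT.isAcyclic.subsingleton_path q j).elim ⟨p, hp⟩ ⟨p', hp'⟩)
  rw [← hlen, ← this]
  exact (SimpleGraph.dist_le _).trans_lt (p.length_takeUntil_lt_length hi hij)

theorem exists_isSpanningTreeOrder {n : ℕ} (q : Fin n) :
    ∃ (T : SimpleGraph (Fin n)) (rank : Equiv.Perm (Fin n)), IsSpanningTreeOrder q T rank := by
  obtain ⟨m, rfl⟩ := Nat.exists_eq_add_of_lt q.pos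
  have hcon : (SimpleGraph.cycleGraph (0 + m + 1)).Connected := SimpleGraph.cycleGraph_connected
  obtain ⟨T, hle, hT⟩ := hcon.exists_isTree_le
  -- Vertices are ranked by distance from the root. `Tuple.sort` sends positions to vertices, hence
  -- the inverse.
  refine ⟨T, (Tuple.sort (T.dist q)).symm, hle, hT, fun i j hij h => ?_⟩
  by_contra! hcon
  have := Tuple.monotone_sort (T.dist q) hcon
  simp only [Function.comp_apply, Equiv.apply_symm_apply] at this
  exact (IsDescendant.dist_lt hT hij h).not_ge this

theorem mainTheorem5 {n : ℕ} (hn : 3 ≤ n) (K : Type*) [Field K] (P : Parcycle n)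
    (Vk : Finset (Fin n)) (hVk : Vk ∈ P.partition.parts) (q : Fin n) (hq : q ∈ Vk) :
    (∃ lam : Fin n → ℕ, P.IsGroebnerWeight Vk lam) ∧
    (∃ (T : SimpleGraph (Fin n)) (rank : Equiv.Perm (Fin n)), IsSpanningTreeOrder q T rank) ∧
    ∀ (lam : Fin n → ℕ), P.IsGroebnerWeight Vk lam →
      ∀ (T : SimpleGraph (Fin n)) (rank : Equiv.Perm (Fin n)), IsSpanningTreeOrder q T rank →
        IsGroebnerBasis (WeightedRevLex.monomialOrder lam rank)
            (P.cutBinomials K Vk) (P.topplingIdeal K) ∧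
          initialIdeal (WeightedRevLex.monomialOrder lam rank) (P.topplingIdeal K) =
            P.parkingIdeal K Vk := by
  refine ⟨P.exists_isGroebnerWeight hn hVk hq, exists_isSpanningTreeOrder q, ?_⟩
  intro lam hlam _ rank _
  exact ⟨Parcycle.isGroebnerBasis_cutBinomials K hVk hlam rank,
    Parcycle.initialIdeal_topplingIdeal K hVk hlam rank⟩
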